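/- Let $X$ be a set, let $f: X\to\mathbb{R}^p$, let $Y\subseteq\mathbb{R}^p$, and let $\phi: Y\to\mathbb{R}^q$. Write $\mathbb{R}^n_+$ for the nonnegative orthant of $\mathbb{R}^n$. For $h: X\to\mathbb{R}^n$, a point $\bar x\in X$ is called a properly efficient solution (in the sense of Benson) of the problem $\min_{x\in X} h(x)$ if $$\operatorname{cl}\Big(\operatorname{cone}\big(h(X)+\mathbb{R}^n_+-h(\bar x)\big)\Big)\cap(-\mathbb{R}^n_+)=\{0\},\qquad \operatorname{cone}(A)=\{ta : t\ge 0,\ a\in A\}.$$ For $y$ in an open set on which $\phi$ is locally Lipschitz, the generalized Jacobian $\partial\phi(y)$ is the convex hull of the set of all limits $\lim_{k\to\infty}\nabla\phi(y_k)$ of $q\times p$ Jacobian matrices, where $y_k\to y$ and $\phi$ is differentiable at each $y_k$. Lemma L2. Assume that: (i) the problem $\min_{x\in X} f(x)$ has at least one properly efficient solution; (ii) $Y$ is open and convex, and $\operatorname{cl} f(X)\subseteq Y$; (iii) $\phi$ is locally Lipschitz on $Y$; (iv) $\ker M\cap\mathbb{R}^p_+=\{0\}$ for all $y\in Y$ and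 all $M\in\partial\phi(y)$; (v) every entry of $M$ is nonnegative, for all $y\in Y$ and all $M\in\partial\phi(y)$. Then every properly efficient solution of $\min_{x\in X}\phi(f(x))$ is a properly efficient solution of $\min_{x\in X} f(x)$. -/

import Mathlib

namespace MultiObj

open Filter Topology Set
open scoped Pointwise

/-- The nonnegative orthant of `ℝⁿ`. -/
def nonnegOrthant (n : ℕ) : Set (EuclideanSpace ℝ (Fin n)) :=
  {y | ∀ i, 0 ≤ y i}

/-- The cone generated by a set `A` (no convexification):
all products `t • a` with `t ≥ 0` and `a ∈ A`. -/
def coneHull {n : ℕ} (A : Set (EuclideanSpace ℝ (Fin n))) : Set (EuclideanSpace ℝ (Fin n)) :=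
  {z | ∃ t : ℝ, 0 ≤ t ∧ ∃ a ∈ A, z = t • a}

/-- `x` is a properly efficient solution (in the sense of Benson) of the multi-objective
problem `min f` over the feasible set `X`:
`cl (cone (f(X) + ℝⁿ₊ - f(x))) ∩ (-ℝⁿ₊) = {0}`. -/
def IsProperlyEfficient {X : Type*} {n : ℕ} (f : X → EuclideanSpace ℝ (Fin n)) (x : X) : Prop :=
  closure (coneHull (range f + nonnegOrthant n - {f x})) ∩ (-nonnegOrthant n) = {0}

/-- The `q × p` Jacobian matrix of `φ` at `y`: the entry `(i, j)` is `∂φᵢ/∂yⱼ`.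
It is only used at points where `φ` is differentiable. -/
noncomputable def jacobian {p q : ℕ} (φ : EuclideanSpace ℝ (Fin p) → EuclideanSpace ℝ (Fin q))
    (y : EuclideanSpace ℝ (Fin p)) : Matrix (Fin q) (Fin p) ℝ :=
  Matrix.of fun i j => (fderiv ℝ φ y (EuclideanSpace.single j 1)) i

/-- Clarke's generalized Jacobian of `φ` at `y`: the convex hull of all limits of Jacobian
matrices `∇φ(u k)` along sequences `u k → y` of points of differentiability of `φ`.
If `y` is interior to a set `Y`, this depends only on the values of `φ` on `Y`. -/
def generalizedJacobian {p q : ℕ} (φ : EuclideanSpace ℝ (Fin p) → EuclideanSpace ℝ (Fin q))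
    (y : EuclideanSpace ℝ (Fin p)) : Set (Matrix (Fin q) (Fin p) ℝ) :=
  convexHull ℝ {M | ∃ u : ℕ → EuclideanSpace ℝ (Fin p),
    (∀ k, DifferentiableAt ℝ φ (u k)) ∧ Tendsto u atTop (𝓝 y) ∧
      Tendsto (fun k => jacobian φ (u k)) atTop (𝓝 M)}

end MultiObj

/-! Let `x` be properly efficient for `φ ∘ f`, and let `t k • (f (z k) + r k - f x)` tend to `d ≤ 0`
with `t k ≥ 0`, `r k ≥ 0`; the claim is `d = 0`. If `t k → 0`, the base point `f x` is immaterial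
and proper efficiency of some `x₀` for `f` concludes. Otherwise `t` is bounded below on a
subsequence, `x₀` forces `f (z k)` to be bounded (`exists_norm_le`), and one may assume `f (z k) → y
∈ Y`. Suppose `d ≠ 0`. Near the segment from `f x` to `y`, compactness and the kernel condition
bound the component sum of the derivative along `-d` below by some `c > 0`
(`exists_pos_le_sum_fderiv`). A mean value inequality then gives `t k • (φ (f (z k)) - φ (f x))`
components at most `o(1)` and component sum at most `o(1) - c` (`increment_le_of_nonneg_fderiv`).
Truncated from below, these vectors stay in the cone and cluster at a nonzero `w ≤ 0`, contradicting
the choice of `x` (`false_of_sum_le`). -/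

open Filter Topology Set MeasureTheory
open scoped Pointwise NNReal

/-! ### Mean value inequality for Lipschitz maps. -/

section MeanValue

variable {E F : Type*} [NormedAddCommGroup E] [NormedSpace ℝ E] [FiniteDimensional ℝ E]
  [NormedAddCommGroup F] [NormedSpace ℝ F] [FiniteDimensional ℝ F]

omit [FiniteDimensional ℝ E] [FiniteDimensional ℝ F] in
/-- A Lipschitz map whose derivative is controlled almost everywhere on a segment has
controlled increments along this segment. -/
theorem apply_sub_le_of_ae_segment {φ : E → F} {U : Set E} {L : ℝ≥0}
    (hU : Convex ℝ U) (hφ : LipschitzOnWith L φ U) (ℓ : F →L[ℝ] ℝ) {a v : E} {K : ℝ}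
    (ha : a ∈ U) (hav : a + v ∈ U)
    (hK : ∀ u ∈ U, DifferentiableAt ℝ φ u → ℓ (fderiv ℝ φ u v) ≤ K)
    (hdiff : ∀ᵐ s : ℝ, a + s • v ∈ U → DifferentiableAt ℝ φ (a + s • v)) :
    ℓ (φ (a + v)) - ℓ (φ a) ≤ K := by
  have hmem : ∀ s ∈ Icc (0 : ℝ) 1, a + s • v ∈ U := fun s hs => by
    have := hU.add_smul_sub_mem ha hav hs
    simpa using this
  have hlip : LipschitzOnWith (‖ℓ‖₊ * (L * ‖v‖₊)) (fun s : ℝ => ℓ (φ (a + s • v)))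
      (uIcc 0 1) := by
    rw [uIcc_of_le zero_le_one]
    have h1 : LipschitzOnWith ‖v‖₊ (fun s : ℝ => a + s • v) (Icc 0 1) := by
      refine LipschitzOnWith.of_dist_le_mul fun s _ t _ => ?_
      rw [dist_add_left, dist_eq_norm, ← sub_smul, norm_smul, mul_comm, dist_eq_norm]
      rfl
    exact ℓ.lipschitz.comp_lipschitzOnWith (hφ.comp h1 hmem)
  have hac := hlip.absolutelyContinuousOnInterval
  have hint := hac.integral_deriv_eq_sub
  have hle : ∫ s in (0 : ℝ)..1, deriv (fun s : ℝ => ℓ (φ (a + s • v))) s ≤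
      ∫ _ in (0 : ℝ)..1, K := by
    refine intervalIntegral.integral_mono_ae_restrict zero_le_one hac.intervalIntegrable_deriv
      intervalIntegrable_const ?_
    rw [EventuallyLE, ae_restrict_iff' measurableSet_Icc]
    filter_upwards [hdiff] with s hs hs01
    have hd := hs (hmem s hs01)
    have hline : HasDerivAt (fun s : ℝ => a + s • v) v s := by
      simpa using ((hasDerivAt_id s).smul_const v).const_add a
    have := ℓ.hasFDerivAt.comp_hasDerivAt s (hd.hasFDerivAt.comp_hasDerivAt s hline)
    have h2 : deriv (fun s : ℝ => ℓ (φ (a + s • v))) s = ℓ (fderiv ℝ φ (a + s • v) v) := this.deriv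
    rw [h2]
    exact hK _ (hmem s hs01) hd
  rw [hint] at hle
  simpa using hle

/-- Mean value inequality for Lipschitz maps on open convex sets: it suffices to control
the derivative at the points of differentiability. -/
theorem apply_sub_le_of_fderiv_le {φ : E → F} {U : Set E} {L : ℝ≥0} (hUo : IsOpen U)
    (hU : Convex ℝ U) (hφ : LipschitzOnWith L φ U) (ℓ : F →L[ℝ] ℝ) {a b : E} {K : ℝ}
    (ha : a ∈ U) (hb : b ∈ U)
    (hK : ∀ u ∈ U, DifferentiableAt ℝ φ u → ℓ (fderiv ℝ φ u (b - a)) ≤ K) :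
    ℓ (φ b) - ℓ (φ a) ≤ K := by
  borelize E
  let μ : Measure E := Measure.addHaar
  set v := b - a with hv
  have hab : a + v = b := by simp [hv]
  have hGm : MeasurableSet {u | u ∈ U → DifferentiableAt ℝ φ u} := by
    have : {u | u ∈ U → DifferentiableAt ℝ φ u} = Uᶜ ∪ {u | DifferentiableAt ℝ φ u} := by
      ext u; simp [imp_iff_not_or]
    rw [this]
    exact hUo.measurableSet.compl.union (measurableSet_of_differentiableAt ℝ φ)
  have hGae : ∀ᵐ u ∂μ, u ∈ {u | u ∈ U → DifferentiableAt ℝ φ u} := by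
    filter_upwards [hφ.ae_differentiableWithinAt_of_mem (μ := μ)] with u hu hmem
    exact (hu hmem).differentiableAt (hUo.mem_nhds hmem)
  -- The given segment may lie in the null set where `φ` is not differentiable. By Fubini, almost
  -- every parallel line meets that set in a null set, so `a` is approximated by starting points of
  -- such lines.
  have hline := (ae_ae_add_linearMap_mem_iff
    (LinearMap.toSpanSingleton ℝ E v) (volume : Measure ℝ) μ hGm).2 hGae
  have hdense : a ∈ closure {y | ∀ᵐ s : ℝ, y + s • v ∈ U → DifferentiableAt ℝ φ (y + s • v)} := by
    have : Dense {y | ∀ᵐ s : ℝ, y + s • v ∈ U → DifferentiableAt ℝ φ (y + s • v)} := by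
      apply Measure.dense_of_ae (μ := μ)
      simpa using hline
    exact this a
  obtain ⟨y, hy, hya⟩ := mem_closure_iff_seq_limit.1 hdense
  have hyb : Tendsto (fun k => y k + v) atTop (𝓝 b) := by
    rw [← hab]; exact hya.add_const v
  have hca : Tendsto (fun k => ℓ (φ (y k))) atTop (𝓝 (ℓ (φ a))) :=
    (ℓ.continuous.tendsto _).comp
      ((hφ.continuousOn.continuousAt (hUo.mem_nhds ha)).tendsto.comp hya)
  have hcb : Tendsto (fun k => ℓ (φ (y k + v))) atTop (𝓝 (ℓ (φ b))) :=
    (ℓ.continuous.tendsto _).comp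
      ((hφ.continuousOn.continuousAt (hUo.mem_nhds hb)).tendsto.comp hyb)
  refine le_of_tendsto (hcb.sub hca) ?_
  filter_upwards [hya.eventually_mem (hUo.mem_nhds ha), hyb.eventually_mem (hUo.mem_nhds hb)]
    with k hka hkb
  exact apply_sub_le_of_ae_segment hU hφ ℓ hka hkb hK (hy k)

end MeanValue

namespace MultiObj

variable {X : Type*} {p q : ℕ}

/-- Stated for an arbitrary `A` because it also serves for limits of derivatives. -/
theorem of_apply_single_mulVec
    (A : EuclideanSpace ℝ (Fin p) →L[ℝ] EuclideanSpace ℝ (Fin q)) (e : EuclideanSpace ℝ (Fin p))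
    (i : Fin q) :
    (Matrix.of fun (i : Fin q) (j : Fin p) => A (EuclideanSpace.single j 1) i).mulVec e.ofLp i
      = A e i := by
  have he : e = ∑ j, e j • EuclideanSpace.single j (1 : ℝ) := by
    ext k
    simp [Pi.single_apply]
  conv_rhs => rw [he]
  simp [Matrix.mulVec, dotProduct, mul_comm]

theorem jacobian_mem_generalizedJacobian
    {φ : EuclideanSpace ℝ (Fin p) → EuclideanSpace ℝ (Fin q)} {u : EuclideanSpace ℝ (Fin p)}
    (hu : DifferentiableAt ℝ φ u) : jacobian φ u ∈ generalizedJacobian φ u :=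
  subset_convexHull ℝ _ ⟨fun _ => u, fun _ => hu, tendsto_const_nhds, tendsto_const_nhds⟩

theorem fderiv_apply_nonneg {φ : EuclideanSpace ℝ (Fin p) → EuclideanSpace ℝ (Fin q)}
    {Y : Set (EuclideanSpace ℝ (Fin p))}
    (hnonneg : ∀ y ∈ Y, ∀ M ∈ generalizedJacobian φ y, ∀ i j, 0 ≤ M i j)
    {u : EuclideanSpace ℝ (Fin p)} (hu : u ∈ Y) (hd : DifferentiableAt ℝ φ u)
    {e : EuclideanSpace ℝ (Fin p)} (he : e ∈ nonnegOrthant p) (i : Fin q) :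
    0 ≤ fderiv ℝ φ u e i := by
  rw [← of_apply_single_mulVec, Matrix.mulVec, dotProduct]
  exact Finset.sum_nonneg fun j _ => mul_nonneg
    (hnonneg u hu _ (jacobian_mem_generalizedJacobian hd) i j) (he j)

/-- In a nonzero nonnegative direction, the derivatives of `φ` near a compact set have
component sums that are bounded away from zero. -/
theorem exists_pos_le_sum_fderiv {φ : EuclideanSpace ℝ (Fin p) → EuclideanSpace ℝ (Fin q)}
    {Y U C : Set (EuclideanSpace ℝ (Fin p))} {L : ℝ≥0}
    (hker : ∀ y ∈ Y, ∀ M ∈ generalizedJacobian φ y,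
      (LinearMap.ker M.mulVecLin : Set (Fin p → ℝ)) ∩ {v | ∀ i, 0 ≤ v i} = {0})
    (hnonneg : ∀ y ∈ Y, ∀ M ∈ generalizedJacobian φ y, ∀ i j, 0 ≤ M i j)
    (hC : IsCompact C) (hCY : C ⊆ Y) (hUC : U ⊆ C) (hU : IsOpen U) (hφ : LipschitzOnWith L φ U)
    {e : EuclideanSpace ℝ (Fin p)} (he : e ∈ nonnegOrthant p) (he0 : e ≠ 0) :
    ∃ c > 0, ∀ u ∈ U, DifferentiableAt ℝ φ u → c ≤ ∑ i, fderiv ℝ φ u e i := by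
  by_contra! hcon
  choose u huU hud hus using fun k : ℕ => hcon (1 / ((k : ℝ) + 1)) (by positivity)
  have : ProperSpace (EuclideanSpace ℝ (Fin p) →L[ℝ] EuclideanSpace ℝ (Fin q)) :=
    FiniteDimensional.proper ℝ _
  have hmem : ∀ k, (u k, fderiv ℝ φ (u k)) ∈ C ×ˢ Metric.closedBall
      (0 : EuclideanSpace ℝ (Fin p) →L[ℝ] EuclideanSpace ℝ (Fin q)) L := fun k =>
    ⟨hUC (huU k), by
      simpa using norm_fderiv_le_of_lipschitzOn ℝ (hU.mem_nhds (huU k)) hφ⟩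
  obtain ⟨⟨y, A⟩, hyA, σ, hσ, hlim⟩ :=
    (hC.prod (isCompact_closedBall _ _)).tendsto_subseq hmem
  have hy : Tendsto (fun k => u (σ k)) atTop (𝓝 y) := (continuous_fst.tendsto _).comp hlim
  have hA : Tendsto (fun k => fderiv ℝ φ (u (σ k))) atTop (𝓝 A) :=
    (continuous_snd.tendsto _).comp hlim
  have hAe : ∀ v i, Tendsto (fun k => fderiv ℝ φ (u (σ k)) v i) atTop (𝓝 (A v i)) := by
    intro v i
    have hc : Continuous
        fun B : EuclideanSpace ℝ (Fin p) →L[ℝ] EuclideanSpace ℝ (Fin q) => B v i := by fun_prop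
    exact (hc.tendsto A).comp hA
  -- The points `u (σ k)` are themselves points of differentiability, so `A` is one of the
  -- generating limits.
  have hM : (Matrix.of fun (i : Fin q) (j : Fin p) => A (EuclideanSpace.single j 1) i) ∈
      generalizedJacobian φ y := by
    refine subset_convexHull ℝ _ ⟨fun k => u (σ k), fun k => hud _, hy, ?_⟩
    exact tendsto_pi_nhds.2 fun i => tendsto_pi_nhds.2 fun j => hAe _ i
  have hpos : ∀ i, 0 ≤ A e i := fun i =>
    ge_of_tendsto' (hAe e i) fun k => fderiv_apply_nonneg hnonneg (hCY (hUC (huU _))) (hud _) he i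
  have hsum : ∑ i, A e i ≤ 0 :=
    le_of_tendsto_of_tendsto' (tendsto_finsetSum _ fun i _ => hAe e i)
      (tendsto_one_div_add_atTop_nhds_zero_nat.comp hσ.tendsto_atTop) fun k => (hus _).le
  have hzero : ∀ i, A e i = 0 := fun i =>
    (Finset.sum_eq_zero_iff_of_nonneg fun i _ => hpos i).1
      (le_antisymm hsum (Finset.sum_nonneg fun i _ => hpos i)) i (Finset.mem_univ i)
  have hmem0 : e.ofLp ∈ ({0} : Set (Fin p → ℝ)) := by
    rw [← hker y (hCY hyA.1) _ hM]
    refine ⟨?_, he⟩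
    rw [SetLike.mem_coe, LinearMap.mem_ker, Matrix.mulVecLin_apply]
    ext i
    rw [of_apply_single_mulVec, hzero i]
    rfl
  exact he0 (by ext i; exact congrFun hmem0 i)

/-! ### Proper efficiency in terms of sequences. -/

theorem isClosed_nonnegOrthant (n : ℕ) : IsClosed (nonnegOrthant n) := by
  simp only [nonnegOrthant, ofPred_forall]
  exact isClosed_iInter fun i => isClosed_le continuous_const (by fun_prop)

theorem smul_mem_nonnegOrthant {n : ℕ} {t : ℝ} (ht : 0 ≤ t) {r : EuclideanSpace ℝ (Fin n)}
    (hr : r ∈ nonnegOrthant n) : t • r ∈ nonnegOrthant n :=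
  fun i => by simpa using mul_nonneg ht (hr i)

theorem IsProperlyEfficient.eq_zero_of_tendsto {n : ℕ} {f : X → EuclideanSpace ℝ (Fin n)} {x : X}
    (hx : IsProperlyEfficient f x) {t : ℕ → ℝ} {z : ℕ → X} {r : ℕ → EuclideanSpace ℝ (Fin n)}
    {d : EuclideanSpace ℝ (Fin n)} (ht : ∀ k, 0 ≤ t k) (hr : ∀ k, r k ∈ nonnegOrthant n)
    (hd : -d ∈ nonnegOrthant n)
    (hlim : Tendsto (fun k => t k • (f (z k) + r k - f x)) atTop (𝓝 d)) : d = 0 := by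
  have : d ∈ closure (coneHull (range f + nonnegOrthant n - {f x})) ∩ (-nonnegOrthant n) := by
    refine ⟨mem_closure_of_tendsto hlim (Eventually.of_forall fun k => ?_), hd⟩
    exact ⟨t k, ht k, _, sub_mem_sub (add_mem_add (mem_range_self _) (hr k)) rfl, rfl⟩
  rw [IsProperlyEfficient] at hx
  rwa [hx] at this

theorem isProperlyEfficient_of_forall_tendsto {n : ℕ} {f : X → EuclideanSpace ℝ (Fin n)} {x : X}
    (h : ∀ (t : ℕ → ℝ) (z : ℕ → X) (r : ℕ → EuclideanSpace ℝ (Fin n))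
      (d : EuclideanSpace ℝ (Fin n)), (∀ k, 0 ≤ t k) → (∀ k, r k ∈ nonnegOrthant n) →
      -d ∈ nonnegOrthant n → Tendsto (fun k => t k • (f (z k) + r k - f x)) atTop (𝓝 d) →
      d = 0) :
    IsProperlyEfficient f x := by
  refine Subset.antisymm ?_ ?_
  · rintro d ⟨hd, hd'⟩
    obtain ⟨w, hw, hlim⟩ := mem_closure_iff_seq_limit.1 hd
    choose t ht a ha hwa using hw
    choose b hb c hc hbc using ha
    choose g hg r hr hgr using hb
    choose z hz using hg
    refine h t z r d ht hr hd' (hlim.congr fun k => ?_)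
    rw [hwa k, ← hbc k, ← hgr k, hz k, mem_singleton_iff.1 (hc k)]
  · rintro _ rfl
    refine ⟨subset_closure ⟨0, le_rfl, f x + 0 - f x, ?_, by simp⟩, fun i => by simp⟩
    exact sub_mem_sub (add_mem_add (mem_range_self _) fun i => by simp) rfl

/-- If the problem has a properly efficient solution, then the points of the image lying
below a bounded set form a bounded set. -/
theorem IsProperlyEfficient.exists_norm_le {n : ℕ} {f : X → EuclideanSpace ℝ (Fin n)} {x : X}
    (hx : IsProperlyEfficient f x) (R : ℝ) :
    ∃ B, ∀ z, ∀ r ∈ nonnegOrthant n, ‖f z + r‖ ≤ R → ‖f z‖ ≤ B := by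
  by_contra! hcon
  choose z r hr hR hB using fun k : ℕ => hcon ((k : ℝ) + 1)
  have hpos : ∀ k, 0 < ‖f (z k)‖ := fun k => lt_trans (by positivity) (hB k)
  have htop : Tendsto (fun k => ‖f (z k)‖) atTop atTop :=
    tendsto_atTop_mono (fun k => by linarith [hB k]) tendsto_natCast_atTop_atTop
  have hinv : Tendsto (fun k => ‖f (z k)‖⁻¹) atTop (𝓝 0) := htop.inv_tendsto_atTop
  have hsphere : ∀ k, ‖f (z k)‖⁻¹ • f (z k) ∈ Metric.sphere (0 : EuclideanSpace ℝ (Fin n)) 1 := by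
    intro k
    rw [mem_sphere_zero_iff_norm, norm_smul, norm_inv, norm_norm, inv_mul_cancel₀ (hpos k).ne']
  obtain ⟨e, he, σ, hσ, hlim⟩ := (isCompact_sphere _ _).tendsto_subseq hsphere
  have hinvσ := hinv.comp hσ.tendsto_atTop
  have hsum : Tendsto (fun k => ‖f (z (σ k))‖⁻¹ • (f (z (σ k)) + r (σ k))) atTop (𝓝 0) := by
    refine squeeze_zero_norm (a := fun k => ‖f (z (σ k))‖⁻¹ * R) (fun k => ?_) ?_
    · rw [norm_smul, norm_inv, norm_norm]
      exact mul_le_mul_of_nonneg_left (hR _) (inv_nonneg.2 (hpos _).le)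
    · simpa using hinvσ.mul_const R
  -- The normalized sums vanish in the limit, so `-e` is the limit of the normalized `r`.
  have hneg : -e ∈ nonnegOrthant n := by
    have h1 := hsum.sub hlim
    rw [zero_sub] at h1
    refine (isClosed_nonnegOrthant n).mem_of_tendsto h1 (Eventually.of_forall fun k => ?_)
    simpa [smul_add] using smul_mem_nonnegOrthant (inv_nonneg.2 (hpos (σ k)).le) (hr (σ k))
  have h0 : e = 0 := by
    refine hx.eq_zero_of_tendsto (t := fun k => ‖f (z (σ k))‖⁻¹) (z := fun k => z (σ k))
      (r := fun _ => 0) (fun k => (inv_nonneg.2 (hpos _).le)) (fun k i => by simp) hneg ?_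
    have h1 := hlim.sub (hinvσ.smul_const (f x))
    simpa [smul_sub] using h1
  simp [h0] at he

/-! ### Increments of `φ` and the contradiction. -/

/-- A linear estimate for increments of a map with nonnegative derivatives: the increment over
`b - a` is controlled by the direction `d` which `t • (b + r - a)` approximates. -/
theorem increment_le_of_nonneg_fderiv {φ : EuclideanSpace ℝ (Fin p) → EuclideanSpace ℝ (Fin q)}
    {U : Set (EuclideanSpace ℝ (Fin p))} {L : ℝ≥0} {c : ℝ} (hUo : IsOpen U) (hU : Convex ℝ U)
    (hφ : LipschitzOnWith L φ U)
    (hnonneg : ∀ u ∈ U, DifferentiableAt ℝ φ u → ∀ e ∈ nonnegOrthant p, ∀ i,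
      0 ≤ fderiv ℝ φ u e i)
    {d : EuclideanSpace ℝ (Fin p)} (hd : -d ∈ nonnegOrthant p)
    (hc : ∀ u ∈ U, DifferentiableAt ℝ φ u → c ≤ ∑ i, fderiv ℝ φ u (-d) i)
    {a b r : EuclideanSpace ℝ (Fin p)} (ha : a ∈ U) (hb : b ∈ U) (hr : r ∈ nonnegOrthant p)
    {t : ℝ} (ht : 0 ≤ t) :
    (∀ i, t * (φ b i - φ a i) ≤ L * ‖t • (b + r - a) - d‖) ∧
      ∑ i, t * (φ b i - φ a i) ≤ q * (L * ‖t • (b + r - a) - d‖) - c := by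
  have key : ∀ u ∈ U, DifferentiableAt ℝ φ u → ∀ i,
      t * fderiv ℝ φ u (b - a) i ≤
        L * ‖t • (b + r - a) - d‖ - fderiv ℝ φ u (-d) i := by
    intro u hu hdiff i
    -- An error term, the direction `d`, and a nonpositive remainder that only lowers the
    -- derivative.
    have h1 : t • (b - a) = (t • (b + r - a) - d) - -d - t • r := by module
    have h2 : t * fderiv ℝ φ u (b - a) i = fderiv ℝ φ u (t • (b - a)) i := by simp
    have h3 : fderiv ℝ φ u (t • (b + r - a) - d) i ≤ L * ‖t • (b + r - a) - d‖ :=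
      calc fderiv ℝ φ u (t • (b + r - a) - d) i
          ≤ ‖fderiv ℝ φ u (t • (b + r - a) - d)‖ :=
            (Real.le_norm_self _).trans (PiLp.norm_apply_le _ i)
        _ ≤ L * ‖t • (b + r - a) - d‖ := (fderiv ℝ φ u).le_of_opNorm_le
            (norm_fderiv_le_of_lipschitzOn ℝ (hUo.mem_nhds hu) hφ) _
    have h4 := hnonneg u hu hdiff (t • r) (smul_mem_nonnegOrthant ht hr) i
    rw [h2, h1, map_sub, map_sub, PiLp.sub_apply, PiLp.sub_apply]
    linarith
  constructor
  · intro i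
    have := apply_sub_le_of_fderiv_le hUo hU hφ (t • EuclideanSpace.proj i) ha hb
      (K := L * ‖t • (b + r - a) - d‖) fun u hu hdiff => by
        have := key u hu hdiff i
        have := hnonneg u hu hdiff (-d) hd i
        simp only [smul_apply, PiLp.proj_apply, smul_eq_mul]
        linarith
    simpa [mul_sub] using this
  · have := apply_sub_le_of_fderiv_le hUo hU hφ (∑ i, t • EuclideanSpace.proj i) ha hb
      (K := q * (L * ‖t • (b + r - a) - d‖) - c) fun u hu hdiff => by
        have h1 := Finset.sum_le_sum fun i (_ : i ∈ Finset.univ) => key u hu hdiff i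
        have h2 := hc u hu hdiff
        simp only [Finset.sum_sub_distrib, Finset.sum_const, Finset.card_univ, Fintype.card_fin,
          nsmul_eq_mul] at h1
        simp only [sum_apply, smul_apply,
          PiLp.proj_apply, smul_eq_mul]
        linarith
    simpa [mul_sub, Finset.sum_sub_distrib] using this

/-- Componentwise truncation of a sequence in the cone generated by the image: upper bounds
tending to `0` and component sums bounded away from zero contradict proper efficiency. -/
theorem IsProperlyEfficient.false_of_sum_le {n : ℕ} {h : X → EuclideanSpace ℝ (Fin n)} {x : X}
    (hx : IsProperlyEfficient h x) {t ε δ : ℕ → ℝ} {z : ℕ → X} {c : ℝ} (hc : 0 < c)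
    (ht : ∀ k, 0 < t k) (hε : Tendsto ε atTop (𝓝 0)) (hδ : Tendsto δ atTop (𝓝 0))
    (hcomp : ∀ k i, t k * (h (z k) i - h x i) ≤ ε k)
    (hsum : ∀ k, ∑ i, t k * (h (z k) i - h x i) ≤ δ k - c) : False := by
  set S : ℕ → Fin n → ℝ := fun k i => t k * (h (z k) i - h x i) with hS
  set W : ℕ → Fin n → ℝ := fun k i => max (S k i) (-c) with hW
  obtain ⟨B, hB⟩ := hε.bddAbove_range
  have hWmem : ∀ k, W k ∈ Icc (fun _ => -c) (fun _ : Fin n => max B 0) := fun k =>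
    ⟨fun i => le_max_right _ _, fun i => max_le
      (((hcomp k i).trans (hB (mem_range_self k))).trans (le_max_left _ _))
      ((neg_nonpos.2 hc.le).trans (le_max_right _ _))⟩
  obtain ⟨w, -, σ, hσ, hlim⟩ := isCompact_Icc.tendsto_subseq hWmem
  have hεσ := hε.comp hσ.tendsto_atTop
  have hδσ := hδ.comp hσ.tendsto_atTop
  have hWle : ∀ k i, W k i ≤ |ε k| := fun k i => max_le ((hcomp k i).trans (le_abs_self _))
    ((neg_nonpos.2 hc.le).trans (abs_nonneg _))
  have hWsum : ∀ k, ∑ i, W k i ≤ max (δ k) (n * |ε k|) - c := by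
    intro k
    -- One truncated component already contributes `-c`, and the others are at most `|ε k|`; without
    -- truncation `hsum` applies.
    by_cases hk : ∃ i, S k i < -c
    · obtain ⟨i, hi⟩ := hk
      have h1 := Finset.single_le_sum (f := fun j => |ε k| - W k j)
        (fun j _ => sub_nonneg.2 (hWle k j)) (Finset.mem_univ i)
      have h2 : W k i = -c := max_eq_right hi.le
      simp only [Finset.sum_sub_distrib, Finset.sum_const, Finset.card_univ, Fintype.card_fin,
        nsmul_eq_mul, h2] at h1
      linarith [le_max_right (δ k) (n * |ε k|), abs_nonneg (ε k)]
    · push Not at hk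
      have h1 : ∑ i, W k i = ∑ i, S k i := Finset.sum_congr rfl fun i _ => max_eq_left (hk i)
      linarith [hsum k, le_max_left (δ k) (n * |ε k|)]
  have hwi : ∀ i, Tendsto (fun k => W (σ k) i) atTop (𝓝 (w i)) := tendsto_pi_nhds.1 hlim
  have hw : ∀ i, w i ≤ 0 := fun i =>
    le_of_tendsto_of_tendsto' (hwi i) (by simpa using hεσ.abs) fun k => hWle (σ k) i
  have hsumw : ∑ i, w i ≤ -c := by
    refine le_of_tendsto_of_tendsto' (tendsto_finsetSum _ fun i _ => hwi i)
      ?_ fun k => hWsum (σ k)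
    simpa using (hδσ.max (hεσ.abs.const_mul (n : ℝ))).sub_const c
  have h0 : WithLp.toLp 2 w = 0 := by
    -- Truncation only raises components, so it amounts to adding an element of the orthant.
    refine hx.eq_zero_of_tendsto (t := fun k => t (σ k)) (z := fun k => z (σ k))
      (r := fun k => (t (σ k))⁻¹ • WithLp.toLp 2 (W (σ k) - S (σ k))) (fun k => (ht _).le)
      (fun k => smul_mem_nonnegOrthant (inv_nonneg.2 (ht _).le)
        fun i => sub_nonneg.2 (le_max_left _ _)) (fun i => by simpa using hw i) ?_
    refine (((PiLp.continuous_toLp 2 _).tendsto w).comp hlim).congr fun k => ?_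
    ext i
    have := (ht (σ k)).ne'
    simp [hS]
    field_simp
    ring
  have hw0 : ∀ i, w i = 0 := fun i => congrArg (fun v : EuclideanSpace ℝ (Fin n) => v i) h0
  simp only [hw0, Finset.sum_const_zero] at hsumw
  linarith

/-- The core of the argument, along a convergent sequence of images. -/
theorem IsProperlyEfficient.eq_zero_of_tendsto_comp
    {f : X → EuclideanSpace ℝ (Fin p)} {Y : Set (EuclideanSpace ℝ (Fin p))}
    {φ : EuclideanSpace ℝ (Fin p) → EuclideanSpace ℝ (Fin q)}
    (hYopen : IsOpen Y) (hYconvex : Convex ℝ Y) (hφ : LocallyLipschitzOn Y φ)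
    (hker : ∀ y ∈ Y, ∀ M ∈ generalizedJacobian φ y,
      (LinearMap.ker M.mulVecLin : Set (Fin p → ℝ)) ∩ {v | ∀ i, 0 ≤ v i} = {0})
    (hnonneg : ∀ y ∈ Y, ∀ M ∈ generalizedJacobian φ y, ∀ i j, 0 ≤ M i j)
    {x : X} (hx : IsProperlyEfficient (φ ∘ f) x) (hxY : f x ∈ Y)
    {t : ℕ → ℝ} {z : ℕ → X} {r : ℕ → EuclideanSpace ℝ (Fin p)}
    {d y : EuclideanSpace ℝ (Fin p)} (ht : ∀ k, 0 < t k) (hr : ∀ k, r k ∈ nonnegOrthant p)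
    (hd : -d ∈ nonnegOrthant p)
    (hlim : Tendsto (fun k => t k • (f (z k) + r k - f x)) atTop (𝓝 d))
    (hy : Tendsto (fun k => f (z k)) atTop (𝓝 y)) (hyY : y ∈ Y) : d = 0 := by
  by_contra hd0
  have hK : IsCompact (segment ℝ (f x) y) := by
    rw [← convexHull_pair]
    exact (Set.toFinite _).isCompact_convexHull ℝ
  obtain ⟨η, hη, hηY⟩ :=
    hK.exists_cthickening_subset_open hYopen (hYconvex.segment_subset hxY hyY)
  have hC : IsCompact (Metric.cthickening η (segment ℝ (f x) y)) := hK.cthickening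
  have hUC := Metric.thickening_subset_cthickening η (segment ℝ (f x) y)
  have hUo : IsOpen (Metric.thickening η (segment ℝ (f x) y)) := Metric.isOpen_thickening
  have hsub := Metric.self_subset_thickening hη (segment ℝ (f x) y)
  obtain ⟨L, hL⟩ := (hφ.mono hηY).exists_lipschitzOnWith_of_compact hC
  have hLU := hL.mono hUC
  obtain ⟨c, hc, hcU⟩ := exists_pos_le_sum_fderiv hker hnonneg hC hηY hUC hUo hLU hd
    (neg_ne_zero.2 hd0)
  obtain ⟨N, hN⟩ := eventually_atTop.1
    (hy.eventually_mem (hUo.mem_nhds (hsub (right_mem_segment ℝ (f x) y))))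
  have hest := fun k => increment_le_of_nonneg_fderiv hUo ((convex_segment _ _).thickening η) hLU
    (fun u hu hdiff e he i => fderiv_apply_nonneg hnonneg (hηY (hUC hu)) hdiff he i) hd hcU
    (hsub (left_mem_segment ℝ (f x) y)) (hN (k + N) (Nat.le_add_left _ _)) (hr (k + N))
    (ht (k + N)).le
  have herr : Tendsto (fun k => L * ‖t (k + N) • (f (z (k + N)) + r (k + N) - f x) - d‖)
      atTop (𝓝 0) := by
    have h1 : Tendsto (fun k => t (k + N) • (f (z (k + N)) + r (k + N) - f x)) atTop (𝓝 d) :=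
      hlim.comp (tendsto_add_atTop_nat N)
    simpa using ((h1.sub_const d).norm).const_mul (L : ℝ)
  exact hx.false_of_sum_le hc (fun k => ht (k + N)) herr
    (by simpa using herr.const_mul (q : ℝ)) (fun k i => (hest k).1 i) fun k => (hest k).2

end MultiObj

theorem lemmaL2 {X : Type*} {p q : ℕ}
    (f : X → EuclideanSpace ℝ (Fin p))
    (Y : Set (EuclideanSpace ℝ (Fin p)))
    (φ : EuclideanSpace ℝ (Fin p) → EuclideanSpace ℝ (Fin q))
    (hne : ∃ x : X, MultiObj.IsProperlyEfficient f x)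
    (hYopen : IsOpen Y) (hYconvex : Convex ℝ Y)
    (hfY : closure (Set.range f) ⊆ Y)
    (hφ : LocallyLipschitzOn Y φ)
    (hker : ∀ y ∈ Y, ∀ M ∈ MultiObj.generalizedJacobian φ y,
      (LinearMap.ker M.mulVecLin : Set (Fin p → ℝ)) ∩ {v | ∀ i, 0 ≤ v i} = {0})
    (hnonneg : ∀ y ∈ Y, ∀ M ∈ MultiObj.generalizedJacobian φ y, ∀ i j, 0 ≤ M i j) :
    {x : X | MultiObj.IsProperlyEfficient (φ ∘ f) x} ⊆
      {x : X | MultiObj.IsProperlyEfficient f x} := by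
  obtain ⟨x₀, hx₀⟩ := hne
  intro x hx
  refine MultiObj.isProperlyEfficient_of_forall_tendsto fun t z r d ht hr hd hlim => ?_
  by_cases ht0 : Tendsto t atTop (𝓝 0)
  -- Changing the base point costs `t k • (f x - f x₀)`, which tends to `0`.
  · refine hx₀.eq_zero_of_tendsto (z := z) ht hr hd ?_
    have h1 := hlim.add (ht0.smul_const (f x - f x₀))
    rw [zero_smul, add_zero] at h1
    exact h1.congr fun k => by module
  · obtain ⟨ε, hε, hfreq⟩ : ∃ ε > 0, ∃ᶠ k in atTop, ε ≤ t k := by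
      by_contra! hcon
      refine ht0 (Metric.tendsto_nhds.2 fun ε hε => ?_)
      filter_upwards [hcon ε hε] with k hk
      rwa [Real.dist_0_eq_abs, abs_of_nonneg (ht k)]
    obtain ⟨σ, hσ, hσε⟩ := extraction_of_frequently_atTop hfreq
    have hlimσ := hlim.comp hσ.tendsto_atTop
    obtain ⟨R, hR⟩ := hlim.norm.bddAbove_range
    have hbound : ∀ k, ‖f (z (σ k)) + r (σ k)‖ ≤ R / ε + ‖f x‖ := by
      intro k
      have h1 : ‖t (σ k) • (f (z (σ k)) + r (σ k) - f x)‖ ≤ R := hR (mem_range_self (σ k))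
      rw [norm_smul, Real.norm_of_nonneg (ht _)] at h1
      have h2 : ‖f (z (σ k)) + r (σ k) - f x‖ ≤ R / ε := by
        rw [le_div_iff₀' hε]
        exact (mul_le_mul_of_nonneg_right (hσε k) (norm_nonneg _)).trans h1
      linarith [norm_sub_norm_le (f (z (σ k)) + r (σ k)) (f x)]
    obtain ⟨B, hB⟩ := hx₀.exists_norm_le (R / ε + ‖f x‖)
    obtain ⟨y, -, τ, hτ, hy⟩ :=
      (isCompact_closedBall (0 : EuclideanSpace ℝ (Fin p)) B).tendsto_subseq
      (x := fun k => f (z (σ k)))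
      fun k => mem_closedBall_zero_iff.2 (hB _ _ (hr _) (hbound k))
    exact hx.eq_zero_of_tendsto_comp (t := fun k => t (σ (τ k))) (z := fun k => z (σ (τ k)))
      (r := fun k => r (σ (τ k))) hYopen hYconvex hφ hker hnonneg
      (hfY (subset_closure (mem_range_self x))) (fun k => hε.trans_le (hσε _))
      (fun k => hr _) hd (hlimσ.comp hτ.tendsto_atTop) hy
      (hfY (mem_closure_of_tendsto hy (Eventually.of_forall fun k => mem_range_self _)))
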